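/- Let $G$ be a finite simple graph with vertex set $V$, and write $i \simeq j$ if $i=j$ or $i$ and $j$ are adjacent. In the algebra $L(\mathbb{C}^V)$ of operators on $\mathbb{C}^V$ put $$S=\operatorname{span}\{|i\rangle\langle j| : i\simeq j\},\qquad S_0=\operatorname{span}\{|i\rangle\langle i| : i\in V\}.$$ Then $S$ is an FP-perfect $S_0$-graph if and only if $G$ is perfect (every induced subgraph $H$ of $G$ satisfies $\chi(H)=\omega(H)$). Here the following notions are used, for a finite-dimensional Hilbert space $A$ and a unital $*$-subalgebra $S_0\subseteq L(A)$. * An $S_0$-graph is a linear subspace $S\subseteq L(A)$ with $S=S^\dagger$, $I\in S$, $S_0\subseteq S$ and $S_0SS_0=S$. Its complement is $S^c=S^\perp+S_0$, with $\perp$ taken for the inner product $\operatorname{Tr}(X^\dagger Y)$. * An orthogonal projection $P$ is $S$-full if $P\,L(A)\,P\subseteq S$. For a set $C$ of positive semidefinite operators, $\operatorname{her}(C)=\{A\ge 0: \exists B\in C,\ A\le B\}$, and $$\mathrm{FP}(S)=\operatorname{her}\bigl(\overline{\operatorname{conv}}\{P : P \text{ an } S\text{-full projection}\}\bigr).$$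 * The anti-blocker of $C$ is $C^\sharp=\{B\ge 0:\operatorname{Tr}(AB)\le 1\text{ for all }A\in C\}$. * Decompose $A=\bigoplus_i A_i\otimes Y_i$ with nonzero $A_i,Y_i$ so that $S_0=\bigoplus_i L(A_i)\otimes I_{Y_i}$, let $P_i$ be the projection onto $A_i\otimes Y_i$, and put $$\Psi(W)=\sum_i (\dim Y_i)^{-1}\, I_{A_i}\otimes\operatorname{Tr}_{A_i}(P_iWP_i),\qquad C^{\Psi}=\{W\ge 0:\Psi(W)\in C\}^\sharp .$$ * An $S_0$-graph $S$ is FP-perfect if $\mathrm{FP}(S)=\mathrm{FP}(S^c)^{\Psi}$. The equivalence holds for every such decomposition of the algebra $S_0$ of diagonal operators. -/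

import Mathlib

open scoped Matrix Kronecker ComplexOrder

namespace NCGraph

section General

variable {n : Type*} [Fintype n] [DecidableEq n]

/-- The orthogonal complement of an operator space for the Hilbert-Schmidt inner product
`⟨Y, X⟩ = Tr (Y† X)`. -/
def orth (S : Submodule ℂ (Matrix n n ℂ)) : Submodule ℂ (Matrix n n ℂ) where
  carrier := {X | ∀ Y ∈ S, (Yᴴ * X).trace = 0}
  add_mem' := by
    intro X X' hX hX' Y hY
    rw [Matrix.mul_add, Matrix.trace_add, hX Y hY, hX' Y hY, add_zero]
  zero_mem' := by
    intro Y _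
    simp
  smul_mem' := by
    intro c X hX Y hY
    rw [Matrix.mul_smul, Matrix.trace_smul, hX Y hY, smul_zero]

/-- `S` is an `S₀`-graph: `S = S†`, `I ∈ S`, `S₀ ⊆ S` and `S₀ S S₀ = S` (products of operator
spaces being the linear spans of the products of their elements). -/
structure IsVertexGraph (S₀ : StarSubalgebra ℂ (Matrix n n ℂ))
    (S : Submodule ℂ (Matrix n n ℂ)) : Prop where
  conjTranspose_mem : ∀ X ∈ S, Xᴴ ∈ S
  one_mem : (1 : Matrix n n ℂ) ∈ S
  vertex_le : Subalgebra.toSubmodule S₀.toSubalgebra ≤ S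
  bimodule : Subalgebra.toSubmodule S₀.toSubalgebra * S *
    Subalgebra.toSubmodule S₀.toSubalgebra = S

/-- The complement `Sᶜ = S^⊥ + S₀` of an `S₀`-graph. -/
def compl (S₀ : StarSubalgebra ℂ (Matrix n n ℂ)) (S : Submodule ℂ (Matrix n n ℂ)) :
    Submodule ℂ (Matrix n n ℂ) :=
  orth S ⊔ Subalgebra.toSubmodule S₀.toSubalgebra

/-- The hereditary closure of a set of positive semidefinite operators. -/
def her (C : Set (Matrix n n ℂ)) : Set (Matrix n n ℂ) :=
  {A | A.PosSemidef ∧ ∃ B ∈ C, (B - A).PosSemidef}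

/-- The anti-blocker of a set of positive semidefinite operators. The trace of a product of two
positive semidefinite matrices is real. -/
def antiblocker (C : Set (Matrix n n ℂ)) : Set (Matrix n n ℂ) :=
  {B | B.PosSemidef ∧ ∀ A ∈ C, (A * B).trace.re ≤ 1}

/-- `P` is an `S`-full projection: an orthogonal projection with `P L(A) P ⊆ S`. -/
def IsFullProjection (S : Submodule ℂ (Matrix n n ℂ)) (P : Matrix n n ℂ) : Prop :=
  IsStarProjection P ∧ ∀ X : Matrix n n ℂ, P * X * P ∈ S

/-- The convex corner generated by the `S`-full projections. -/
def fp (S : Submodule ℂ (Matrix n n ℂ)) : Set (Matrix n n ℂ) :=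
  her (closure (convexHull ℝ {P | IsFullProjection S P}))

/-- A decomposition `A = ⨁ᵢ Aᵢ ⊗ Yᵢ` of the Hilbert space (given by a unitary `U` from the right
hand side, in coordinates, to the left hand side) with `S₀ = ⨁ᵢ L(Aᵢ) ⊗ I`. -/
structure BlockDecomposition (S₀ : StarSubalgebra ℂ (Matrix n n ℂ)) where
  /-- the number of blocks -/
  r : ℕ
  /-- the dimensions of the `Aᵢ` -/
  dimA : Fin r → ℕ
  /-- the dimensions of the `Yᵢ` -/
  dimY : Fin r → ℕ
  dimA_pos : ∀ i, 0 < dimA i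
  dimY_pos : ∀ i, 0 < dimY i
  /-- the identification of `⨁ᵢ Aᵢ ⊗ Yᵢ` with `A` -/
  U : Matrix n (Σ i : Fin r, Fin (dimA i) × Fin (dimY i)) ℂ
  conjTranspose_mul_self : Uᴴ * U = 1
  mul_conjTranspose_self : U * Uᴴ = 1
  mem_iff : ∀ X : Matrix n n ℂ, X ∈ S₀ ↔
    ∃ B : ∀ i, Matrix (Fin (dimA i)) (Fin (dimA i)) ℂ,
      X = U * Matrix.blockDiagonal' (fun i => B i ⊗ₖ (1 : Matrix (Fin (dimY i)) (Fin (dimY i)) ℂ))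
        * Uᴴ

/-- The partial trace over the first tensor factor. -/
def traceFst {a y : Type*} [Fintype a] (M : Matrix (a × y) (a × y) ℂ) : Matrix y y ℂ :=
  Matrix.of fun q q' => ∑ p, M (p, q) (p, q')

/-- `Ψ(W) = ∑ᵢ dim(Yᵢ)⁻¹ I_{Aᵢ} ⊗ Tr_{Aᵢ} (Pᵢ W Pᵢ)`, with `Pᵢ` the projection onto `Aᵢ ⊗ Yᵢ`. -/
noncomputable def blockScale {S₀ : StarSubalgebra ℂ (Matrix n n ℂ)} (D : BlockDecomposition S₀)
    (W : Matrix n n ℂ) : Matrix n n ℂ :=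
  D.U * Matrix.blockDiagonal' (fun i =>
    ((D.dimY i : ℂ)⁻¹) • ((1 : Matrix (Fin (D.dimA i)) (Fin (D.dimA i)) ℂ) ⊗ₖ
      traceFst (Matrix.blockDiag' (D.Uᴴ * W * D.U) i))) * D.Uᴴ

/-- The `Ψ`-anti-blocker `{W ≥ 0 : Ψ(W) ∈ C}^♯`. -/
def psiAntiblocker {S₀ : StarSubalgebra ℂ (Matrix n n ℂ)} (D : BlockDecomposition S₀)
    (C : Set (Matrix n n ℂ)) : Set (Matrix n n ℂ) :=
  antiblocker {W | W.PosSemidef ∧ blockScale D W ∈ C}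

/-- `S` is an FP-perfect `S₀`-graph: an `S₀`-graph with `FP(S) = FP^Ψ(Sᶜ)`. -/
def IsFPPerfect {S₀ : StarSubalgebra ℂ (Matrix n n ℂ)} (D : BlockDecomposition S₀)
    (S : Submodule ℂ (Matrix n n ℂ)) : Prop :=
  IsVertexGraph S₀ S ∧ fp S = psiAntiblocker D (fp (compl S₀ S))

end General

section Classical

/-- `G` is perfect: every induced subgraph has chromatic number equal to its clique number. -/
def IsPerfect {V : Type*} (G : SimpleGraph V) : Prop :=
  ∀ s : Set V, (G.induce s).chromaticNumber = ((G.induce s).cliqueNum : ℕ∞)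

variable {V : Type*} [Fintype V] [DecidableEq V]

/-- `span {|i⟩⟨j| : i = j or i adjacent to j}`. -/
def graphSpace (G : SimpleGraph V) : Submodule ℂ (Matrix V V ℂ) :=
  Submodule.span ℂ {X | ∃ i j, (i = j ∨ G.Adj i j) ∧ X = Matrix.single i j (1 : ℂ)}

theorem mem_diagSpan_iff (X : Matrix V V ℂ) :
    X ∈ Submodule.span ℂ (Set.range fun i : V => Matrix.single i i (1 : ℂ)) ↔
      ∃ d : V → ℂ, X = Matrix.diagonal d := by
  constructor
  · intro hX
    induction hX using Submodule.span_induction with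
    | mem x hx =>
      obtain ⟨i, rfl⟩ := hx
      exact ⟨Pi.single i 1, by rw [Matrix.diagonal_single]⟩
    | zero => exact ⟨0, by simp⟩
    | add x y _ _ hx hy =>
      obtain ⟨d, rfl⟩ := hx
      obtain ⟨e, rfl⟩ := hy
      exact ⟨fun i => d i + e i, by rw [Matrix.diagonal_add]⟩
    | smul c x _ hx =>
      obtain ⟨d, rfl⟩ := hx
      exact ⟨c • d, by rw [Matrix.diagonal_smul]⟩
  · rintro ⟨d, rfl⟩
    have h : Matrix.diagonal d = ∑ i, d i • Matrix.single i i (1 : ℂ) := by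
      ext a b
      simp only [Matrix.diagonal_apply, Matrix.sum_apply, Matrix.smul_apply, Matrix.single_apply,
        smul_eq_mul, mul_ite, mul_one, mul_zero]
      by_cases hab : a = b
      · subst hab; simp
      · rw [if_neg hab]
        symm
        apply Finset.sum_eq_zero
        intro i _
        rw [if_neg]
        rintro ⟨rfl, rfl⟩
        exact hab rfl
    rw [h]
    exact Submodule.sum_mem _ fun i _ =>
      Submodule.smul_mem _ _ (Submodule.subset_span ⟨i, rfl⟩)

/-- The vertex algebra `S₀ = span {|i⟩⟨i| : i ∈ V}`. -/
def vertexAlgebra (V : Type*) [Fintype V] [DecidableEq V] :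
    StarSubalgebra ℂ (Matrix V V ℂ) where
  carrier := Submodule.span ℂ (Set.range fun i : V => Matrix.single i i (1 : ℂ))
  mul_mem' := by
    intro X Y hX hY
    obtain ⟨d, rfl⟩ := (mem_diagSpan_iff X).1 hX
    obtain ⟨e, rfl⟩ := (mem_diagSpan_iff Y).1 hY
    exact (mem_diagSpan_iff _).2 ⟨_, Matrix.diagonal_mul_diagonal d e⟩
  add_mem' := fun hX hY => Submodule.add_mem _ hX hY
  algebraMap_mem' := fun c => (mem_diagSpan_iff _).2 ⟨fun _ => c, rfl⟩
  star_mem' := by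
    intro X hX
    obtain ⟨d, rfl⟩ := (mem_diagSpan_iff X).1 hX
    exact (mem_diagSpan_iff _).2 ⟨star d, Matrix.diagonal_conjTranspose d⟩

theorem mem_vertexAlgebra_iff (X : Matrix V V ℂ) :
    X ∈ vertexAlgebra V ↔ ∃ d : V → ℂ, X = Matrix.diagonal d :=
  mem_diagSpan_iff X

/-- The points of `V` as indices of one-dimensional blocks. -/
noncomputable def vertexEquiv (V : Type*) [Fintype V] :
    V ≃ (Σ _ : Fin (Fintype.card V), Fin 1 × Fin 1) :=
  (Fintype.equivFin V).trans
    { toFun := fun i => ⟨i, 0, 0⟩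
      invFun := fun x => x.1
      left_inv := fun _ => rfl
      right_inv := fun _ => Sigma.ext rfl (heq_of_eq (Subsingleton.elim _ _)) }

/-- The corresponding permutation matrix. -/
noncomputable def vertexUnitary (V : Type*) [Fintype V] :
    Matrix V (Σ _ : Fin (Fintype.card V), Fin 1 × Fin 1) ℂ :=
  Matrix.of fun v x => if vertexEquiv V v = x then 1 else 0

/-- A block decomposition of the vertex algebra exists: all `Aᵢ` and `Yᵢ` are one-dimensional. -/
noncomputable def vertexDecomposition (V : Type*) [Fintype V] [DecidableEq V] :
    BlockDecomposition (vertexAlgebra V) where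
  r := Fintype.card V
  dimA := fun _ => 1
  dimY := fun _ => 1
  dimA_pos := fun _ => one_pos
  dimY_pos := fun _ => one_pos
  U := vertexUnitary V
  conjTranspose_mul_self := by
    ext a b
    obtain ⟨v, rfl⟩ := (vertexEquiv V).surjective a
    obtain ⟨w, rfl⟩ := (vertexEquiv V).surjective b
    simp [Matrix.mul_apply, vertexUnitary, Matrix.one_apply, eq_comm]
  mul_conjTranspose_self := by
    ext a b
    simp [Matrix.mul_apply, vertexUnitary, Matrix.one_apply, eq_comm]
  mem_iff := by
    intro X
    have key : ∀ M : Matrix (Σ _ : Fin (Fintype.card V), Fin 1 × Fin 1)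
        (Σ _ : Fin (Fintype.card V), Fin 1 × Fin 1) ℂ,
        vertexUnitary V * M * (vertexUnitary V)ᴴ =
        M.submatrix (vertexEquiv V) (vertexEquiv V) := by
      intro M
      ext a b
      simp [Matrix.mul_apply, vertexUnitary]
    simp only [key, mem_vertexAlgebra_iff]
    have hB : ∀ B : Fin (Fintype.card V) → Matrix (Fin 1) (Fin 1) ℂ,
        (Matrix.blockDiagonal' fun i => B i ⊗ₖ (1 : Matrix (Fin 1) (Fin 1) ℂ)) =
          Matrix.diagonal fun x => B x.1 0 0 := by
      intro B
      ext ⟨i, p⟩ ⟨j, q⟩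
      have hpq : p = q := Subsingleton.elim _ _
      have hp : p = 0 := Subsingleton.elim _ _
      subst hpq hp
      by_cases hij : i = j
      · subst hij
        simp [Matrix.blockDiagonal'_apply]
      · simp [Matrix.blockDiagonal'_apply, hij]
    constructor
    · rintro ⟨d, rfl⟩
      refine ⟨fun i => Matrix.of fun _ _ => d ((vertexEquiv V).symm ⟨i, 0, 0⟩), ?_⟩
      rw [hB, Matrix.submatrix_diagonal_equiv]
      congr 1
      funext v
      have : (⟨((vertexEquiv V) v).1, 0, 0⟩ :
          Σ _ : Fin (Fintype.card V), Fin 1 × Fin 1) = vertexEquiv V v := by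
        generalize vertexEquiv V v = x
        obtain ⟨i, p⟩ := x
        congr 1
        exact Subsingleton.elim _ _
      simp [this]
    · rintro ⟨B, rfl⟩
      exact ⟨_, by rw [hB, Matrix.submatrix_diagonal_equiv]⟩

end Classical

end NCGraph

namespace NCGraph

/-! Over the diagonal algebra everything reduces to polytopes in `V → ℝ`. In any block decomposition
of that algebra all `Aᵢ` and `Yᵢ` are one-dimensional, so `Ψ` keeps the diagonal of `W` and kills
the rest (`blockScale_vertexAlgebra`); moreover the complement of the space of `G` is the space of
`Gᶜ` (`compl_graphSpace`). A full projection is dominated by the coordinate projection of a clique,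
which is itself full (`IsFullProjection.exists_clique`). Hence `FP` consists of the positive
semidefinite matrices lying below a diagonal matrix whose entries form a point of the clique
polytope.

The inclusion of `FP(S)` in the `Ψ`-anti-blocker always holds, because a clique and an independent
set share at most one vertex. The reverse inclusion concerns `IsCliquePolyhedral`. Tested on
diagonal matrices, it yields this property for `G`. Conversely, the property for `Gᶜ` implies the
inclusion: by Hahn-Banach, a matrix outside `FP(S)` is separated from it by some `W ≥ 0`
(`exists_posSemidef_separating`), and the property shows that `W` is an admissible test for the
anti-blocker.

What remains is the classical theory of Fulkerson and Lovász: anti-blocking duality carries the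
property from `G` to `Gᶜ` (`IsCliquePolyhedral.compl`), and the property for `Gᶜ` is equivalent to
perfection of `G`. One direction uses vertex replication (`exists_indep_decomposition`), the other a
counting argument that peels off colour classes (`exists_coloring_of_isCliquePolyhedral_compl`). -/

open scoped Pointwise in
theorem isClosed_setOf_exists_sub_mem {E : Type*} [AddCommGroup E] [TopologicalSpace E]
    [IsTopologicalAddGroup E] {K Q : Set E} (hK : IsCompact K) (hQ : IsClosed Q) :
    IsClosed {x | ∃ y ∈ K, y - x ∈ Q} := by
  have h : {x | ∃ y ∈ K, y - x ∈ Q} = (-Q) + K := by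
    ext x
    constructor
    · rintro ⟨y, hy, hx⟩
      exact ⟨x - y, by simpa using hx, y, hy, by simp⟩
    · rintro ⟨z, hz, y, hy, rfl⟩
      exact ⟨y, hy, by simpa using hz⟩
  rw [h]
  exact hQ.neg.add_right_of_isCompact hK

/-! ### Perfect graphs and the polyhedral condition -/

section Combinatorics

variable {V : Type*} [DecidableEq V]

/-- The indicator vector of a finite set of vertices. -/
def indVec (K : Finset V) : V → ℝ := fun v => if v ∈ K then 1 else 0

/-- The convex hull of the indicator vectors of the cliques. -/
def cliqueHull (G : SimpleGraph V) : Set (V → ℝ) :=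
  convexHull ℝ {x | ∃ K : Finset V, G.IsClique K ∧ x = indVec K}

/-- The vectors dominated by an element of the clique polytope. -/
def cliqueCorner (G : SimpleGraph V) : Set (V → ℝ) :=
  {x | ∃ y ∈ cliqueHull G, x ≤ y}

/-- Every nonnegative vector with weight at most one on each clique of `Gᶜ` is dominated by an
element of the clique polytope of `G`. -/
def IsCliquePolyhedral (G : SimpleGraph V) : Prop :=
  ∀ x : V → ℝ, 0 ≤ x → (∀ K : Finset V, Gᶜ.IsClique K → ∑ v ∈ K, x v ≤ 1) → x ∈ cliqueCorner G

theorem convex_cliqueCorner (G : SimpleGraph V) : Convex ℝ (cliqueCorner G) := by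
  rintro x ⟨x', hx', hx⟩ y ⟨y', hy', hy⟩ a b ha hb hab
  exact ⟨a • x' + b • y', convex_convexHull ℝ _ hx' hy' ha hb hab,
    add_le_add (smul_le_smul_of_nonneg_left hx ha) (smul_le_smul_of_nonneg_left hy hb)⟩

theorem indVec_mem_cliqueHull {G : SimpleGraph V} {K : Finset V} (hK : G.IsClique K) :
    indVec K ∈ cliqueHull G :=
  subset_convexHull ℝ _ ⟨K, hK, rfl⟩

theorem indVec_nonneg (K : Finset V) : 0 ≤ indVec K := fun v => by
  unfold indVec; split_ifs <;> simp

theorem cliqueHull_induction {G : SimpleGraph V} {T : Set (V → ℝ)} (hT : Convex ℝ T)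
    (h : ∀ K : Finset V, G.IsClique K → indVec K ∈ T) {y : V → ℝ} (hy : y ∈ cliqueHull G) :
    y ∈ T := by
  refine convexHull_min ?_ hT hy
  rintro x ⟨K, hK, rfl⟩
  exact h K hK

theorem card_inter_le_one {G : SimpleGraph V} {K S : Finset V} (hK : G.IsClique K)
    (hS : Gᶜ.IsClique S) : (K ∩ S).card ≤ 1 := by
  rw [Finset.card_le_one]
  intro a ha b hb
  rw [Finset.mem_inter] at ha hb
  by_contra hab
  exact ((SimpleGraph.compl_adj G a b).1 (hS ha.2 hb.2 hab)).2 (hK ha.1 hb.1 hab)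

variable [Fintype V]

theorem sum_mul_indVec (x : V → ℝ) (K : Finset V) : ∑ v, x v * indVec K v = ∑ v ∈ K, x v := by
  simp [indVec]

theorem isCompact_cliqueHull (G : SimpleGraph V) : IsCompact (cliqueHull G) := by
  refine Set.Finite.isCompact_convexHull ℝ ((Set.finite_range (indVec (V := V))).subset ?_)
  rintro x ⟨K, -, rfl⟩
  exact ⟨K, rfl⟩

theorem isClosed_cliqueCorner (G : SimpleGraph V) : IsClosed (cliqueCorner G) := by
  have := isClosed_setOf_exists_sub_mem (isCompact_cliqueHull G)
    (isClosed_Ici (a := (0 : V → ℝ)))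
  simpa [cliqueCorner] using this

theorem sum_mul_le_of_mem_cliqueHull {G : SimpleGraph V} {x : V → ℝ} {c : ℝ}
    (hx : ∀ K : Finset V, G.IsClique K → ∑ v ∈ K, x v ≤ c) {y : V → ℝ} (hy : y ∈ cliqueHull G) :
    ∑ v, x v * y v ≤ c := by
  refine cliqueHull_induction (T := {y | ∑ v, x v * y v ≤ c}) ?_ ?_ hy
  · refine convex_halfSpace_le ⟨?_, ?_⟩ c
    · intro y z; simp [mul_add, Finset.sum_add_distrib]
    · intro a y; simp [Finset.mul_sum, mul_left_comm]
  · intro K hK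
    simpa [sum_mul_indVec] using hx K hK

/-- A weighted form of the replication lemma: in a perfect graph, a weight that is at most `N` on
every clique is the sum of the indicators of `N` independent sets. -/
theorem exists_indep_decomposition {G : SimpleGraph V} (hG : IsPerfect G) (w : V → ℕ) (N : ℕ)
    (hw : ∀ K : Finset V, G.IsClique K → ∑ v ∈ K, w v ≤ N) :
    ∃ S : Fin N → Finset V, (∀ i, Gᶜ.IsClique (S i)) ∧
      ∀ v, w v = ∑ i, if v ∈ S i then 1 else 0 := by
  induction hm : ∑ v, w v using Nat.strong_induction_on generalizing w N with
  | _ m ih =>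
  by_cases h1 : ∀ v, w v ≤ 1
  · set s : Set V := {v | w v = 1} with hs
    have hcol : (G.induce s).Colorable N := by
      rw [← SimpleGraph.chromaticNumber_le_iff_colorable, hG s]
      obtain ⟨K, hK⟩ := (G.induce s).exists_isNClique_cliqueNum
      have h2 := hw (K.map (Function.Embedding.subtype _)) (by
        intro a ha b hb hab
        simp only [Finset.coe_map, Function.Embedding.subtype_apply, Set.mem_image] at ha hb
        obtain ⟨a, ha, rfl⟩ := ha
        obtain ⟨b, hb, rfl⟩ := hb
        exact hK.1 ha hb (fun h => hab (by rw [h])))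
      rw [Finset.sum_map] at h2
      have h3 : ∀ x ∈ K, w (Function.Embedding.subtype (· ∈ s) x) = 1 := fun x _ => x.2
      rw [Finset.sum_congr rfl h3] at h2
      simp only [Finset.sum_const, smul_eq_mul, mul_one, hK.2] at h2
      exact_mod_cast h2
    obtain ⟨c⟩ := hcol
    classical
    refine ⟨fun i => Finset.univ.filter fun v => ∃ h : v ∈ s, c ⟨v, h⟩ = i, ?_, ?_⟩
    · intro i a ha b hb hab
      simp only [Finset.coe_filter, Finset.mem_univ, true_and, Set.mem_ofPred_eq] at ha hb
      obtain ⟨ha, hac⟩ := ha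
      obtain ⟨hb, hbc⟩ := hb
      refine (SimpleGraph.compl_adj G a b).2 ⟨hab, fun hadj => ?_⟩
      exact c.valid (v := ⟨a, ha⟩) (w := ⟨b, hb⟩) hadj (hac.trans hbc.symm)
    · intro v
      by_cases hv : v ∈ s
      · have : w v = 1 := hv
        simp [hv, this]
      · have : w v = 0 := by have := h1 v; have h4 : ¬ w v = 1 := hv; omega
        simp [hv, this]
  · push Not at h1
    obtain ⟨v, hv⟩ := h1
    have hlt : ∑ u, (w u - if u = v then 1 else 0) < m := by
      rw [← hm]
      refine Finset.sum_lt_sum (fun u _ => Nat.sub_le _ _) ⟨v, Finset.mem_univ v, ?_⟩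
      simp; omega
    -- Lowering the weight of `v` by one leaves it positive, since `w v ≥ 2`; so some class `S i₀`
    -- of the smaller decomposition contains `v`. This class is then split off from `w` itself.
    obtain ⟨S, hS, hSw⟩ := ih _ hlt (fun u => w u - if u = v then 1 else 0) N
      (fun K hK => (Finset.sum_le_sum fun u _ => Nat.sub_le _ _).trans (hw K hK)) rfl
    obtain ⟨i₀, hi₀⟩ : ∃ i, v ∈ S i := by
      by_contra! hne
      have := hSw v
      simp [hne] at this
      omega
    obtain ⟨N, rfl⟩ : ∃ M, N = M + 1 := ⟨N - 1, by have := i₀.2; omega⟩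
    have hge : ∀ u, (if u ∈ S i₀ then 1 else 0) ≤ w u := by
      intro u
      have h2 : (if u ∈ S i₀ then 1 else 0) ≤ ∑ i, if u ∈ S i then 1 else 0 :=
        Finset.single_le_sum (f := fun i => if u ∈ S i then 1 else 0)
          (fun i _ => Nat.zero_le _) (Finset.mem_univ i₀)
      have := hSw u
      omega
    have hlt' : ∑ u, (w u - if u ∈ S i₀ then 1 else 0) < m := by
      rw [← hm]
      refine Finset.sum_lt_sum (fun u _ => Nat.sub_le _ _) ⟨v, Finset.mem_univ v, ?_⟩
      simp [hi₀]; omega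
    have hsum : ∀ K : Finset V, ∑ u ∈ K, w u =
        ∑ u ∈ K, (w u - if u ∈ S i₀ then 1 else 0) + (K ∩ S i₀).card := by
      intro K
      rw [← Finset.filter_mem_eq_inter, Finset.card_filter, ← Finset.sum_add_distrib]
      exact Finset.sum_congr rfl fun u _ => (Nat.sub_add_cancel (hge u)).symm
    -- A clique `K` violating the bound `N` would have full weight `N + 1` and miss `S i₀`, hence
    -- avoid `v`. On such a `K` the lowered weight equals `w`, so `N + 1` is a sum of `N + 1`
    -- intersection sizes, each at most one and one of them zero.
    obtain ⟨T, hT, hTw⟩ := ih _ hlt' (fun u => w u - if u ∈ S i₀ then 1 else 0) N (by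
      intro K hK
      by_contra! hcon
      have h3 := hsum K
      have h4 := hw K hK
      have h5 : (K ∩ S i₀).card = 0 := by omega
      have h6 : ∑ u ∈ K, w u = N + 1 := by omega
      have hvK : v ∉ K := fun hvK => by
        rw [Finset.card_eq_zero] at h5
        exact Finset.notMem_empty v (h5 ▸ Finset.mem_inter.2 ⟨hvK, hi₀⟩)
      have h7 : ∑ u ∈ K, w u = ∑ i, (K ∩ S i).card := by
        simp_rw [← Finset.filter_mem_eq_inter, Finset.card_filter]
        rw [Finset.sum_comm]
        refine Finset.sum_congr rfl fun u hu => ?_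
        rw [← hSw u, if_neg (fun h : u = v => hvK (h ▸ hu)), Nat.sub_zero]
      have h8 : ∑ i, (K ∩ S i).card < ∑ _i : Fin (N + 1), 1 :=
        Finset.sum_lt_sum (fun i _ => card_inter_le_one hK (hS i))
          ⟨i₀, Finset.mem_univ _, by omega⟩
      simp at h8
      omega) rfl
    refine ⟨Fin.cons (S i₀) T, ?_, ?_⟩
    · intro i
      refine Fin.cases ?_ (fun j => ?_) i
      · simpa using hS i₀
      · simpa using hT j
    · intro u
      rw [Fin.sum_univ_succ]
      simp only [Fin.cons_zero, Fin.cons_succ]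
      have := hTw u
      have := hge u
      omega

/-- The integer weights `⌊n x⌋` are at most `n` on each clique, so they split into `n` independent
sets, whose average is a point of the independent set polytope equal to `⌊n x⌋ / n`. Closedness of
the corner allows `n → ∞`. -/
theorem IsPerfect.isCliquePolyhedral_compl {G : SimpleGraph V} (hG : IsPerfect G) :
    IsCliquePolyhedral Gᶜ := by
  intro x hx hxK
  rw [compl_compl] at hxK
  have hlim : Filter.Tendsto (fun n : ℕ => fun v => (⌊x v * (n : ℝ)⌋₊ : ℝ) / (n : ℝ))
      Filter.atTop (nhds x) := by
    rw [tendsto_pi_nhds]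
    intro v
    exact (tendsto_nat_floor_mul_div_atTop (hx v)).comp tendsto_natCast_atTop_atTop
  refine (isClosed_cliqueCorner Gᶜ).mem_of_tendsto hlim ?_
  filter_upwards [Filter.eventually_gt_atTop 0] with n hn
  have hn' : (0 : ℝ) < n := by exact_mod_cast hn
  obtain ⟨S, hS, hSw⟩ := exists_indep_decomposition hG (fun v => ⌊x v * (n : ℝ)⌋₊) n (by
    intro K hK
    have h1 : (∑ v ∈ K, (⌊x v * (n : ℝ)⌋₊ : ℝ)) ≤ n := by
      calc (∑ v ∈ K, (⌊x v * (n : ℝ)⌋₊ : ℝ)) ≤ ∑ v ∈ K, x v * n :=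
            Finset.sum_le_sum fun v _ => Nat.floor_le (mul_nonneg (hx v) hn'.le)
        _ = (∑ v ∈ K, x v) * n := by rw [Finset.sum_mul]
        _ ≤ 1 * n := mul_le_mul_of_nonneg_right (hxK K hK) hn'.le
        _ = n := one_mul _
    exact_mod_cast h1)
  refine ⟨∑ i, (n : ℝ)⁻¹ • indVec (S i), ?_, ?_⟩
  · refine (convex_convexHull ℝ _).sum_mem (fun i _ => by positivity) ?_
      (fun i _ => indVec_mem_cliqueHull (hS i))
    simp [hn'.ne']
  · intro v
    have h2 : (⌊x v * (n : ℝ)⌋₊ : ℝ) = ∑ i, indVec (S i) v := by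
      simp only [indVec]
      exact_mod_cast hSw v
    simp only [h2, Finset.sum_apply, Pi.smul_apply, smul_eq_mul, ← Finset.mul_sum]
    rw [div_eq_inv_mul]

/-- It is enough to find one independent set meeting every clique of maximal allowed size in `s`: it
becomes a colour class, and induction colours the rest. The polyhedral property supplies it by
averaging. -/
theorem exists_coloring_of_isCliquePolyhedral_compl {G : SimpleGraph V}
    (hG : IsCliquePolyhedral Gᶜ) (N : ℕ) (s : Finset V)
    (hs : ∀ K ⊆ s, G.IsClique (K : Set V) → K.card ≤ N) :
    ∃ c : V → ℕ, (∀ v ∈ s, c v < N) ∧ ∀ u ∈ s, ∀ v ∈ s, G.Adj u v → c u ≠ c v := by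
  classical
  induction N generalizing s with
  | zero =>
    have : s = ∅ := by
      by_contra hne
      obtain ⟨v, hv⟩ := Finset.nonempty_iff_ne_empty.2 hne
      have := hs {v} (by simpa using hv) (by simp)
      simp at this
    subst this
    exact ⟨fun _ => 0, by simp, by simp⟩
  | succ N ih =>
    have hN : (0 : ℝ) < (N + 1 : ℕ) := by positivity
    obtain ⟨y, hy, hxy⟩ := hG (((N + 1 : ℕ) : ℝ)⁻¹ • indVec s)
      (smul_nonneg (by positivity) (indVec_nonneg s)) (by
        intro K hK
        rw [compl_compl] at hK
        have h1 : ((K ∩ s).card : ℝ) ≤ (N + 1 : ℕ) := by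
          exact_mod_cast hs (K ∩ s) Finset.inter_subset_right
            (hK.subset (by simp))
        simp only [Pi.smul_apply, smul_eq_mul, ← Finset.mul_sum]
        simp only [indVec, Finset.sum_ite_mem, Finset.sum_const, nsmul_eq_mul, mul_one]
        rw [inv_mul_le_iff₀ hN, mul_one]
        exact h1)
    -- `f v` counts the members of `F` through `v`. Pairing `f` with the indicator of `s` divided by
    -- `N + 1` gives exactly the cardinality of `F`, so some independent set has `f`-weight at least
    -- that. It meets each member of `F` at most once, hence it meets all of them.
    set F : Finset (Finset V) :=
      s.powerset.filter fun K => G.IsClique (K : Set V) ∧ K.card = N + 1 with hF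
    set f : V → ℝ := fun v => ∑ K ∈ F, indVec K v with hf
    have hfsum : ∀ S : Finset V, ∑ v ∈ S, f v = ∑ K ∈ F, ((K ∩ S).card : ℝ) := by
      intro S
      simp only [hf]
      rw [Finset.sum_comm]
      refine Finset.sum_congr rfl fun K _ => ?_
      simp [indVec, Finset.inter_comm]
    have hfy : (F.card : ℝ) ≤ ∑ v, f v * y v := by
      calc (F.card : ℝ) = ∑ v, f v * (((N + 1 : ℕ) : ℝ)⁻¹ • indVec s) v := by
            simp only [Pi.smul_apply, smul_eq_mul]
            simp_rw [mul_left_comm (f _), ← Finset.mul_sum]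
            rw [sum_mul_indVec, hfsum]
            have : ∀ K ∈ F, ((K ∩ s).card : ℝ) = (N + 1 : ℕ) := by
              intro K hK
              rw [hF, Finset.mem_filter, Finset.mem_powerset] at hK
              rw [Finset.inter_eq_left.2 hK.1, hK.2.2]
            rw [Finset.sum_congr rfl this, Finset.sum_const, nsmul_eq_mul]
            field_simp
        _ ≤ ∑ v, f v * y v := Finset.sum_le_sum fun v _ =>
            mul_le_mul_of_nonneg_left (hxy v) (Finset.sum_nonneg fun K _ => indVec_nonneg K v)
    obtain ⟨S, hS, hSF⟩ : ∃ S : Finset V, Gᶜ.IsClique S ∧ ∀ K ∈ F, (K ∩ S).card ≠ 0 := by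
      by_contra! hcon
      have h2 : ∀ S : Finset V, Gᶜ.IsClique S → ∑ v ∈ S, f v ≤ (F.card : ℝ) - 1 := by
        intro S hS
        obtain ⟨K, hK, hK0⟩ := hcon S hS
        have h3 : ∑ K ∈ F, (K ∩ S).card < ∑ K ∈ F, 1 :=
          Finset.sum_lt_sum (fun K hK => card_inter_le_one (Finset.mem_filter.1 hK).2.1 hS)
            ⟨K, hK, by omega⟩
        rw [hfsum]
        rw [Finset.sum_const, smul_eq_mul, mul_one, Nat.lt_iff_add_one_le] at h3
        have h4 : (∑ K ∈ F, ((K ∩ S).card : ℝ)) + 1 ≤ F.card := by exact_mod_cast h3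
        linarith
      have := sum_mul_le_of_mem_cliqueHull h2 hy
      linarith
    obtain ⟨c, hc, hcv⟩ := ih (s \ S) (by
      intro K hKs hK
      have h5 := hs K (hKs.trans Finset.sdiff_subset) hK
      by_contra! h6
      refine hSF K (Finset.mem_filter.2 ⟨Finset.mem_powerset.2
        (hKs.trans Finset.sdiff_subset), hK, by omega⟩) ?_
      rw [Finset.card_eq_zero, ← Finset.disjoint_iff_inter_eq_empty]
      exact Finset.disjoint_of_subset_left hKs Finset.sdiff_disjoint)
    refine ⟨fun v => if v ∈ S then N else c v, ?_, ?_⟩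
    · intro v hv
      by_cases hvS : v ∈ S
      · simp [hvS]
      · simpa [hvS] using (hc v (Finset.mem_sdiff.2 ⟨hv, hvS⟩)).trans (Nat.lt_succ_self N)
    · intro u hu v hv huv
      by_cases huS : u ∈ S <;> by_cases hvS : v ∈ S
      · exact absurd huv ((SimpleGraph.compl_adj G u v).1 (hS huS hvS huv.ne)).2
      · simpa [huS, hvS] using (hc v (Finset.mem_sdiff.2 ⟨hv, hvS⟩)).ne'
      · simpa [huS, hvS] using (hc u (Finset.mem_sdiff.2 ⟨hu, huS⟩)).ne
      · simpa [huS, hvS] using hcv u (Finset.mem_sdiff.2 ⟨hu, huS⟩) v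
          (Finset.mem_sdiff.2 ⟨hv, hvS⟩) huv

theorem IsCliquePolyhedral.isPerfect {G : SimpleGraph V} (hG : IsCliquePolyhedral Gᶜ) :
    IsPerfect G := by
  classical
  intro s
  refine le_antisymm ?_ SimpleGraph.cliqueNum_le_chromaticNumber
  obtain ⟨c, hc, hcv⟩ := exists_coloring_of_isCliquePolyhedral_compl hG
    (G.induce s).cliqueNum s.toFinset (by
      intro K hKs hK
      have hKs' : ∀ v ∈ K, v ∈ s := fun v hv => Set.mem_toFinset.1 (hKs hv)
      have h1 := SimpleGraph.IsClique.card_le_cliqueNum (G := G.induce s)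
        (t := K.subtype (· ∈ s)) (tc := by
          intro a ha b hb hab
          exact hK (by simpa using ha) (by simpa using hb) (fun h => hab (Subtype.ext h)))
      rwa [Finset.card_subtype, Finset.filter_true_of_mem hKs'] at h1)
  rw [SimpleGraph.chromaticNumber_le_iff_colorable]
  refine ⟨SimpleGraph.Coloring.mk
    (fun v => ⟨c v, hc v (Set.mem_toFinset.2 v.2)⟩) ?_⟩
  intro u v huv h
  exact hcv u (Set.mem_toFinset.2 u.2) v (Set.mem_toFinset.2 v.2) huv (by simpa using h)

/-- The antiblocking duality of the clique and the independent set polytopes. -/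
theorem IsCliquePolyhedral.compl {G : SimpleGraph V} (hG : IsCliquePolyhedral G) :
    IsCliquePolyhedral Gᶜ := by
  intro x hx hxK
  rw [compl_compl] at hxK
  by_contra hmem
  obtain ⟨f, u, hfu, hux⟩ := geometric_hahn_banach_closed_point (convex_cliqueCorner Gᶜ)
    (isClosed_cliqueCorner Gᶜ) hmem
  set b : V → ℝ := fun v => f (Pi.single v 1) with hb
  have hfb : ∀ z, f z = ∑ v, b v * z v := by
    intro z
    conv_lhs => rw [pi_eq_sum_univ' z]
    rw [map_sum]
    refine Finset.sum_congr rfl fun v _ => ?_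
    rw [map_smul, smul_eq_mul, mul_comm]
  set b' : V → ℝ := fun v => max (b v) 0 with hb'
  have hb'0 : ∀ v, 0 ≤ b' v := fun v => le_max_right _ _
  have hb'K : ∀ K : Finset V, Gᶜ.IsClique K → ∑ v ∈ K, b' v < u := by
    -- Vertices with negative coefficient are dropped from `K`; what is left is still independent,
    -- so the positive part of the functional obeys the same bound.
    intro K hK
    have h1 := hfu (indVec (K.filter fun v => 0 ≤ b v))
      ⟨_, indVec_mem_cliqueHull (hK.subset (Finset.coe_subset.2 (Finset.filter_subset _ _))), le_rfl⟩
    rw [hfb, sum_mul_indVec, Finset.sum_filter] at h1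
    refine lt_of_eq_of_lt (Finset.sum_congr rfl fun v _ => ?_) h1
    by_cases h : 0 ≤ b v
    · simp [hb', h]
    · simp [hb', h, (not_le.1 h).le]
  have hu : 0 < u := by simpa using hb'K ∅ (by simp)
  obtain ⟨y, hy, hby⟩ := hG (u⁻¹ • b') (smul_nonneg (by positivity) hb'0) (by
    intro K hK
    simp only [Pi.smul_apply, smul_eq_mul, ← Finset.mul_sum]
    rw [inv_mul_le_iff₀ hu, mul_one]
    exact (hb'K K hK).le)
  have h2 := sum_mul_le_of_mem_cliqueHull hxK hy
  have h3 : ∑ v, b v * x v ≤ u * ∑ v, x v * y v := by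
    rw [Finset.mul_sum]
    refine Finset.sum_le_sum fun v _ => ?_
    have h4 : b' v ≤ u * y v := by
      have := hby v
      rwa [Pi.smul_apply, smul_eq_mul, inv_mul_le_iff₀ hu] at this
    calc b v * x v ≤ u * y v * x v :=
          mul_le_mul_of_nonneg_right ((le_max_left _ _).trans h4) (hx v)
      _ = u * (x v * y v) := by ring
  rw [hfb] at hux
  nlinarith

end Combinatorics

/-! ### Block decompositions of the diagonal algebra -/

section Blocks

variable {V : Type*} [Fintype V] [DecidableEq V]

theorem blockDiagonal'_eq_diagonal {ι : Type*} [DecidableEq ι] {m : ι → Type*}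
    [∀ i, DecidableEq (m i)] [hm : ∀ i, Subsingleton (m i)] (M : ∀ i, Matrix (m i) (m i) ℂ) :
    Matrix.blockDiagonal' M = Matrix.diagonal fun x => M x.1 x.2 x.2 := by
  ext ⟨i, p⟩ ⟨j, q⟩
  by_cases hij : i = j
  · subst hij
    obtain rfl := Subsingleton.elim p q
    simp
  · rw [Matrix.blockDiagonal'_apply_ne _ _ _ hij, Matrix.diagonal_apply_ne]
    exact fun h => hij (congrArg Sigma.fst h)

theorem mul_diagonal_mul_conjTranspose_apply {m n : Type*} [Fintype n] [DecidableEq n]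
    (U : Matrix m n ℂ) (d : n → ℂ) (a b : m) :
    (U * Matrix.diagonal d * Uᴴ) a b = ∑ y, U a y * d y * star (U b y) := by
  rw [Matrix.mul_apply]
  simp only [Matrix.mul_diagonal, Matrix.conjTranspose_apply]

theorem exists_column_ne_zero (D : BlockDecomposition (vertexAlgebra V))
    (x : Σ i : Fin D.r, Fin (D.dimA i) × Fin (D.dimY i)) : ∃ v, D.U v x ≠ 0 := by
  by_contra! h
  have h1 := congrFun (congrFun D.conjTranspose_mul_self x) x
  simp [Matrix.mul_apply, h] at h1

/-- The rank-one projection at a vertex lies in the algebra, but a nonzero block `B ⊗ I` has rank at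
least `dim Yᵢ`. The proof compares the entries on `Yᵢ` at a fixed index of `Aᵢ`: a rank-one matrix
cannot be a nonzero multiple of the identity in dimension two or more. -/
theorem subsingleton_dimY (D : BlockDecomposition (vertexAlgebra V)) (i : Fin D.r) :
    Subsingleton (Fin (D.dimY i)) := by
  refine ⟨fun q q' => ?_⟩
  by_contra hq
  let p : Fin (D.dimA i) := ⟨0, D.dimA_pos i⟩
  obtain ⟨v, hv⟩ := exists_column_ne_zero D ⟨i, p, q⟩
  obtain ⟨B, hB⟩ := (D.mem_iff (Matrix.diagonal (Pi.single v (1 : ℂ)))).1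
    ((mem_vertexAlgebra_iff _).2 ⟨_, rfl⟩)
  have hB' : D.Uᴴ * Matrix.diagonal (Pi.single v (1 : ℂ)) * D.U = Matrix.blockDiagonal' fun i =>
      B i ⊗ₖ (1 : Matrix (Fin (D.dimY i)) (Fin (D.dimY i)) ℂ) := by
    rw [hB]
    simp only [Matrix.mul_assoc, D.conjTranspose_mul_self, Matrix.mul_one]
    rw [← Matrix.mul_assoc, D.conjTranspose_mul_self, Matrix.one_mul]
  have hentry : ∀ q q', star (D.U v ⟨i, p, q⟩) * D.U v ⟨i, p, q'⟩ =
      B i p p * (1 : Matrix (Fin (D.dimY i)) (Fin (D.dimY i)) ℂ) q q' := by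
    intro q q'
    have h1 := congrFun (congrFun hB' ⟨i, p, q⟩) ⟨i, p, q'⟩
    rw [Matrix.blockDiagonal'_apply_eq] at h1
    rw [Matrix.mul_apply] at h1
    simpa [Matrix.mul_diagonal, Pi.single_apply] using h1
  have h1 := hentry q q
  have h2 := hentry q' q'
  have h3 := hentry q q'
  rw [Matrix.one_apply_eq, mul_one] at h1 h2
  rw [Matrix.one_apply_ne hq, mul_zero] at h3
  have h4 : D.U v ⟨i, p, q'⟩ = 0 :=
    (mul_eq_zero.1 h3).resolve_left (star_ne_zero.2 hv)
  rw [h4, mul_zero] at h2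
  rw [← h2] at h1
  exact (mul_eq_zero.1 h1).elim (star_ne_zero.2 hv) hv

/-- An off-diagonal matrix unit of `L(Aᵢ)` would be a nonzero element of square zero, and diagonal
matrices have none. -/
theorem subsingleton_dimA (D : BlockDecomposition (vertexAlgebra V)) (i : Fin D.r) :
    Subsingleton (Fin (D.dimA i)) := by
  refine ⟨fun p p' => ?_⟩
  by_contra hp
  let q : Fin (D.dimY i) := ⟨0, D.dimY_pos i⟩
  let B : ∀ j, Matrix (Fin (D.dimA j)) (Fin (D.dimA j)) ℂ := Pi.single i (Matrix.single p p' 1)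
  have hBB : ∀ j, B j * B j = 0 := by
    intro j
    by_cases hj : j = i
    · subst hj
      simp [B, Matrix.single_mul_single_of_ne _ _ _ _ (Ne.symm hp)]
    · simp [B, hj]
  let M := Matrix.blockDiagonal' fun j =>
    B j ⊗ₖ (1 : Matrix (Fin (D.dimY j)) (Fin (D.dimY j)) ℂ)
  have hMM : M * M = 0 := by
    simp only [M]
    rw [← Matrix.blockDiagonal'_mul]
    simp only [← Matrix.mul_kronecker_mul, hBB, Matrix.zero_kronecker]
    exact Matrix.blockDiagonal'_zero
  obtain ⟨d, hd⟩ := (mem_vertexAlgebra_iff _).1 ((D.mem_iff (D.U * M * D.Uᴴ)).2 ⟨B, rfl⟩)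
  have hdd : Matrix.diagonal d * Matrix.diagonal d = 0 := by
    rw [← hd]
    calc D.U * M * D.Uᴴ * (D.U * M * D.Uᴴ) = D.U * M * (D.Uᴴ * D.U) * M * D.Uᴴ := by
          simp only [Matrix.mul_assoc]
      _ = D.U * (M * M) * D.Uᴴ := by
          rw [D.conjTranspose_mul_self, Matrix.mul_one]; simp only [Matrix.mul_assoc]
      _ = 0 := by rw [hMM]; simp
  have hd0 : Matrix.diagonal d = 0 := by
    rw [Matrix.diagonal_mul_diagonal, Matrix.diagonal_eq_zero] at hdd
    rw [Matrix.diagonal_eq_zero]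
    funext v
    simpa using congrFun hdd v
  have hM0 : M = 0 := by
    calc M = (D.Uᴴ * D.U) * M * (D.Uᴴ * D.U) := by simp [D.conjTranspose_mul_self]
      _ = D.Uᴴ * (D.U * M * D.Uᴴ) * D.U := by simp only [Matrix.mul_assoc]
      _ = 0 := by rw [hd, hd0]; simp
  have h1 := congrFun (congrFun hM0 ⟨i, p, q⟩) ⟨i, p', q⟩
  simp only [M] at h1
  rw [Matrix.blockDiagonal'_apply_eq] at h1
  simp [B] at h1

/-- For the vertex algebra, `Ψ` is the conditional expectation onto the diagonal. -/
theorem blockScale_vertexAlgebra (D : BlockDecomposition (vertexAlgebra V)) (W : Matrix V V ℂ) :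
    blockScale D W = Matrix.diagonal fun v => W v v := by
  have := subsingleton_dimA D
  have := subsingleton_dimY D
  have hsub : ∀ x y : Σ i : Fin D.r, Fin (D.dimA i) × Fin (D.dimY i), y.1 = x.1 ↔ y = x := by
    rintro ⟨i, p⟩ ⟨j, q⟩
    constructor
    · rintro rfl
      rw [Subsingleton.elim p q]
    · exact fun h => congrArg Sigma.fst h
  -- The projection onto column `x` of `U` belongs to the algebra, so it is diagonal; thus every
  -- column is supported on a single vertex.
  have hcol : ∀ x a b, a ≠ b → D.U a x * star (D.U b x) = 0 := by
    intro x a b hab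
    obtain ⟨d, hd⟩ := (mem_vertexAlgebra_iff _).1 ((D.mem_iff _).2
      ⟨fun j => if j = x.1 then 1 else 0, rfl⟩)
    rw [blockDiagonal'_eq_diagonal] at hd
    have h1 := congrFun (congrFun hd a) b
    rw [mul_diagonal_mul_conjTranspose_apply, Matrix.diagonal_apply_ne _ hab,
      Finset.sum_eq_single x] at h1
    · simpa using h1
    · intro y _ hy
      simp [mt (hsub x y).1 hy]
    · simp
  have hnorm : ∀ x, ∑ v, star (D.U v x) * D.U v x = 1 := by
    intro x
    simpa [Matrix.mul_apply] using congrFun (congrFun D.conjTranspose_mul_self x) x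
  have hdim : ∀ i, D.dimY i = 1 := fun i =>
    le_antisymm (by simpa using Fintype.card_le_one_iff_subsingleton.2 (this i)) (D.dimY_pos i)
  rw [blockScale, blockDiagonal'_eq_diagonal]
  have hdiag : ∀ x : Σ i : Fin D.r, Fin (D.dimA i) × Fin (D.dimY i),
      (((D.dimY x.1 : ℂ)⁻¹) • ((1 : Matrix (Fin (D.dimA x.1)) (Fin (D.dimA x.1)) ℂ) ⊗ₖ
      traceFst (Matrix.blockDiag' (D.Uᴴ * W * D.U) x.1))) x.2 x.2 = (D.Uᴴ * W * D.U) x x := by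
    rintro ⟨i, p, q⟩
    simp [hdim, traceFst, Fintype.sum_subsingleton _ p, Matrix.blockDiag'_apply]
  simp only [hdiag]
  ext a b
  rw [mul_diagonal_mul_conjTranspose_apply]
  by_cases hab : a = b
  · subst hab
    rw [Matrix.diagonal_apply_eq]
    have hterm : ∀ y, D.U a y * (D.Uᴴ * W * D.U) y y * star (D.U a y) =
        W a a * (D.U a y * star (D.U a y)) := by
      intro y
      by_cases h0 : D.U a y = 0
      · simp [h0]
      · have hz : ∀ c, c ≠ a → D.U c y = 0 := fun c hc =>
          (mul_eq_zero.1 (hcol y c a hc)).resolve_right (star_ne_zero.2 h0)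
        have h1 : star (D.U a y) * D.U a y = 1 := by
          rw [← hnorm y, Finset.sum_eq_single a]
          · intro c _ hc; simp [hz c hc]
          · simp
        have h2 : (D.Uᴴ * W * D.U) y y = star (D.U a y) * W a a * D.U a y := by
          rw [Matrix.mul_apply, Finset.sum_eq_single a, Matrix.mul_apply, Finset.sum_eq_single a]
          · simp
          · intro c _ hc; simp [hz c hc]
          · simp
          · intro c _ hc; simp [hz c hc]
          · simp
        rw [h2]
        linear_combination (W a a * D.U a y * star (D.U a y)) * h1
    rw [Finset.sum_congr rfl fun y _ => hterm y, ← Finset.mul_sum]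
    have h3 : ∑ y, D.U a y * star (D.U a y) = 1 := by
      simpa [Matrix.mul_apply] using congrFun (congrFun D.mul_conjTranspose_self a) a
    rw [h3, mul_one]
  · rw [Matrix.diagonal_apply_ne _ hab]
    refine Finset.sum_eq_zero fun y _ => ?_
    linear_combination (D.Uᴴ * W * D.U) y y * hcol y a b hab

end Blocks

/-! ### Operator spaces of graphs and their complements -/

section GraphSpace

variable {V : Type*} [Fintype V] [DecidableEq V]

theorem mem_graphSpace_iff {G : SimpleGraph V} {X : Matrix V V ℂ} :
    X ∈ graphSpace G ↔ ∀ i j, X i j ≠ 0 → i = j ∨ G.Adj i j := by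
  constructor
  · intro hX
    induction hX using Submodule.span_induction with
    | mem x hx =>
      obtain ⟨a, b, hab, rfl⟩ := hx
      intro i j hij
      rw [Matrix.single_apply] at hij
      obtain ⟨rfl, rfl⟩ := (ite_ne_right_iff.1 hij).1
      exact hab
    | zero => simp
    | add x y _ _ hx hy =>
      intro i j hij
      by_cases h : x i j = 0
      · exact hy i j fun h' => hij (by simp [h, h'])
      · exact hx i j h
    | smul c x _ hx =>
      intro i j hij
      exact hx i j fun h' => hij (by simp [h'])
  · intro h
    rw [Matrix.matrix_eq_sum_single X]
    refine Submodule.sum_mem _ fun i _ => Submodule.sum_mem _ fun j _ => ?_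
    by_cases hij : X i j = 0
    · simp [hij]
    · have : Matrix.single i j (X i j) = X i j • Matrix.single i j (1 : ℂ) := by simp
      rw [this]
      exact Submodule.smul_mem _ _ (Submodule.subset_span ⟨i, j, h i j hij, rfl⟩)

theorem vertexAlgebra_le_graphSpace (G : SimpleGraph V) :
    Subalgebra.toSubmodule (vertexAlgebra V).toSubalgebra ≤ graphSpace G := by
  intro X hX
  obtain ⟨d, rfl⟩ := (mem_vertexAlgebra_iff X).1 hX
  rw [mem_graphSpace_iff]
  intro i j hij
  left
  by_contra h
  exact hij (Matrix.diagonal_apply_ne _ h)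

theorem isVertexGraph_graphSpace (G : SimpleGraph V) :
    IsVertexGraph (vertexAlgebra V) (graphSpace G) where
  conjTranspose_mem := by
    intro X hX
    rw [mem_graphSpace_iff] at hX ⊢
    intro i j hij
    refine (hX j i fun h => hij (by simp [h])).imp Eq.symm fun h => h.symm
  one_mem := vertexAlgebra_le_graphSpace G (vertexAlgebra V).one_mem
  vertex_le := vertexAlgebra_le_graphSpace G
  bimodule := by
    refine le_antisymm ?_ ?_
    · refine Submodule.mul_le.2 fun X hX Y hY => ?_
      obtain ⟨e, rfl⟩ := (mem_vertexAlgebra_iff Y).1 hY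
      refine Submodule.mul_induction_on hX (fun A hA B hB => ?_) (fun A B hA hB => ?_)
      · obtain ⟨d, rfl⟩ := (mem_vertexAlgebra_iff A).1 hA
        rw [mem_graphSpace_iff] at hB ⊢
        intro i j hij
        refine hB i j fun h => hij ?_
        simp [Matrix.mul_diagonal, Matrix.diagonal_mul, h]
      · rw [add_mul]
        exact Submodule.add_mem _ hA hB
    · intro X hX
      have h1 : (1 : Matrix V V ℂ) ∈ Subalgebra.toSubmodule (vertexAlgebra V).toSubalgebra :=
        (vertexAlgebra V).one_mem
      simpa using Submodule.mul_mem_mul (Submodule.mul_mem_mul h1 hX) h1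

theorem compl_graphSpace (G : SimpleGraph V) :
    compl (vertexAlgebra V) (graphSpace G) = graphSpace Gᶜ := by
  refine le_antisymm (sup_le ?_ (vertexAlgebra_le_graphSpace _)) ?_
  · intro X hX
    rw [mem_graphSpace_iff]
    intro i j hij
    by_contra! hcon
    refine hij ?_
    have hadj : G.Adj i j := by
      by_contra h
      exact hcon.2 ((SimpleGraph.compl_adj G i j).2 ⟨hcon.1, h⟩)
    have := hX (Matrix.single i j 1) (Submodule.subset_span ⟨i, j, Or.inr hadj, rfl⟩)
    simpa [Matrix.trace_single_mul] using this
  · intro X hX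
    rw [mem_graphSpace_iff] at hX
    have hsplit : X = (X - Matrix.diagonal fun v => X v v) + Matrix.diagonal fun v => X v v := by
      simp
    rw [hsplit]
    refine Submodule.add_mem_sup ?_ ((mem_vertexAlgebra_iff _).2 ⟨_, rfl⟩)
    intro Y hY
    rw [mem_graphSpace_iff] at hY
    simp only [Matrix.trace, Matrix.diag_apply, Matrix.mul_apply, Matrix.conjTranspose_apply]
    refine Finset.sum_eq_zero fun j _ => Finset.sum_eq_zero fun i _ => ?_
    by_cases hij : i = j
    · subst hij; simp
    · by_cases hY0 : Y i j = 0
      · simp [hY0]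
      · have hadj := (hY i j hY0).resolve_left hij
        have : X i j = 0 := by
          by_contra h0
          exact ((SimpleGraph.compl_adj G i j).1 ((hX i j h0).resolve_left hij)).2 hadj
        simp [this, hij]

end GraphSpace

/-! ### Positive semidefinite matrices and trace duality -/

section PosSemidef

variable {V : Type*}

theorem convex_posSemidef_sub {T : Set (Matrix V V ℂ)} (hT : Convex ℝ T) :
    Convex ℝ {A | ∃ M ∈ T, (M - A).PosSemidef} := by
  rintro A ⟨M, hM, hMA⟩ B ⟨N, hN, hNB⟩ a b ha hb hab
  refine ⟨a • M + b • N, hT hM hN ha hb hab, ?_⟩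
  have h : a • M + b • N - (a • A + b • B) = a • (M - A) + b • (N - B) := by module
  rw [h]
  exact (hMA.smul ha).add (hNB.smul hb)

variable [Fintype V]

theorem re_trace_mul_nonneg {A B : Matrix V V ℂ} (hA : A.PosSemidef) (hB : B.PosSemidef) :
    0 ≤ (A * B).trace.re := by
  obtain ⟨m, v, rfl⟩ := Matrix.posSemidef_iff_eq_sum_vecMulVec.1 hA
  rw [Finset.sum_mul, Matrix.trace_sum, Complex.re_sum]
  refine Finset.sum_nonneg fun i _ => ?_
  rw [Matrix.vecMulVec_mul, Matrix.trace_vecMulVec, dotProduct_comm, ← Matrix.dotProduct_mulVec]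
  exact (Complex.le_def.1 (hB.dotProduct_mulVec_nonneg (v i))).1

theorem isClosed_posSemidef : IsClosed {A : Matrix V V ℂ | A.PosSemidef} := by
  simp only [Matrix.posSemidef_iff_dotProduct_mulVec, Set.ofPred_and, Set.ofPred_forall]
  refine IsClosed.inter ?_ (isClosed_iInter fun x => ?_)
  · exact isClosed_eq (by fun_prop) continuous_id
  · exact isClosed_le continuous_const (by fun_prop)

theorem exists_re_trace_mul (f : Matrix V V ℂ →ₗ[ℝ] ℝ) :
    ∃ W : Matrix V V ℂ, W.IsHermitian ∧ ∀ X : Matrix V V ℂ, X.IsHermitian →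
      f X = (W * X).trace.re := by
  classical
  -- Since `f` is only real-linear, its values on `E_ij` and on `i E_ij` are both recorded, as real
  -- part and negated imaginary part. Passing to the Hermitian part of `W₀` below does not change
  -- the pairing with Hermitian matrices.
  set W₀ : Matrix V V ℂ := Matrix.of fun j i =>
    (f (Matrix.single i j 1) : ℂ) - Complex.I * f (Matrix.single i j Complex.I) with hW₀
  have h₀ : ∀ X, f X = (W₀ * X).trace.re := by
    intro X
    have hX : ∀ i j, f (Matrix.single i j (X i j)) = (W₀ j i * X i j).re := by
      intro i j
      have h1 : Matrix.single i j (X i j) = (X i j).re • Matrix.single i j (1 : ℂ) +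
          (X i j).im • Matrix.single i j Complex.I := by
        simp only [Matrix.smul_single, ← Matrix.single_add]
        congr 1
        simp [Complex.re_add_im]
      rw [h1, map_add, map_smul, map_smul]
      simp [hW₀]
      ring
    conv_lhs => rw [Matrix.matrix_eq_sum_single X]
    simp only [map_sum, hX, Matrix.trace, Matrix.diag_apply, Matrix.mul_apply, Complex.re_sum]
    exact Finset.sum_comm
  refine ⟨(1 / 2 : ℝ) • (W₀ + W₀ᴴ), ?_, ?_⟩
  · rw [Matrix.IsHermitian, Matrix.conjTranspose_smul, Matrix.conjTranspose_add,
      Matrix.conjTranspose_conjTranspose, add_comm W₀ᴴ]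
    simp
  · intro X hX
    have h1 : (W₀ᴴ * X).trace = star (W₀ * X).trace := by
      rw [← Matrix.trace_conjTranspose, Matrix.conjTranspose_mul, hX.eq, Matrix.trace_mul_comm]
    rw [Matrix.smul_mul, Matrix.add_mul, Matrix.trace_smul, Matrix.trace_add, h1, h₀ X]
    simp
    ring

end PosSemidef

/-! ### Full projections, the corner `FP` and the two inclusions -/

section FullProjection

variable {V : Type*} [DecidableEq V]

/-- The diagonal matrix with the given real entries. -/
def realDiagonal : (V → ℝ) →ₗ[ℝ] Matrix V V ℂ where
  toFun x := Matrix.diagonal fun v => (x v : ℂ)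
  map_add' x y := by simp [Matrix.diagonal_add]
  map_smul' a x := by
    rw [RingHom.id_apply, ← Matrix.diagonal_smul]
    congr 1
    funext v
    simp

theorem realDiagonal_apply (x : V → ℝ) :
    realDiagonal x = Matrix.diagonal fun v => (x v : ℂ) := rfl

theorem continuous_realDiagonal : Continuous (realDiagonal : (V → ℝ) → Matrix V V ℂ) := by
  change Continuous fun x : V → ℝ => Matrix.diagonal fun v => (x v : ℂ)
  fun_prop

theorem posSemidef_realDiagonal {x : V → ℝ} (hx : 0 ≤ x) : (realDiagonal x).PosSemidef := by
  rw [realDiagonal_apply, Matrix.posSemidef_diagonal_iff]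
  intro v
  exact_mod_cast hx v

theorem realDiagonal_re_diag {W : Matrix V V ℂ} (hW : W.PosSemidef) :
    (Matrix.diagonal fun v => W v v) = realDiagonal fun v => (W v v).re := by
  rw [realDiagonal_apply]
  congr 1
  funext v
  exact (Complex.conj_eq_iff_re.1 (hW.isHermitian.apply v v)).symm

variable [Fintype V]

theorem re_trace_mul_realDiagonal (W : Matrix V V ℂ) (x : V → ℝ) :
    (W * realDiagonal x).trace.re = ∑ v, (W v v).re * x v := by
  simp [realDiagonal_apply, Matrix.trace, Matrix.mul_diagonal]

theorem isFullProjection_realDiagonal_indVec {G : SimpleGraph V} {K : Finset V}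
    (hK : G.IsClique K) : IsFullProjection (graphSpace G) (realDiagonal (indVec K)) := by
  refine ⟨⟨?_, ?_⟩, fun X => ?_⟩
  · rw [IsIdempotentElem, realDiagonal_apply, Matrix.diagonal_mul_diagonal]
    congr 1
    funext v
    by_cases h : v ∈ K <;> simp [indVec, h]
  · exact (posSemidef_realDiagonal (indVec_nonneg K)).isHermitian
  · rw [mem_graphSpace_iff]
    intro i j hij
    rw [realDiagonal_apply, Matrix.mul_diagonal, Matrix.diagonal_mul] at hij
    have hi : i ∈ K := by by_contra h; simp [indVec, h] at hij
    have hj : j ∈ K := by by_contra h; simp [indVec, h] at hij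
    by_cases h : i = j
    · exact Or.inl h
    · exact Or.inr (hK hi hj h)

/-- Let `K` be the set of vertices with `P v v ≠ 0`. The `(a, b)` entry of `P E_ab P` is `P a a * P
b b`, so fullness makes `K` a clique. A zero diagonal entry of a projection forces its whole column
to vanish, so `P` lives on the coordinates of `K`. -/
theorem IsFullProjection.exists_clique {G : SimpleGraph V} {P : Matrix V V ℂ}
    (hP : IsFullProjection (graphSpace G) P) :
    ∃ K : Finset V, G.IsClique K ∧ (realDiagonal (indVec K) - P).PosSemidef := by
  obtain ⟨⟨hid, hsa⟩, hfull⟩ := hP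
  have hh : ∀ i j, star (P j i) = P i j := fun i j =>
    congrFun (congrFun (show Pᴴ = P from hsa) i) j
  have hdiag : ∀ v, P v v = ∑ u, star (P u v) * P u v := by
    intro v
    conv_lhs => rw [← hid.eq, Matrix.mul_apply]
    simp only [hh]
  have hzero : ∀ v, P v v = 0 → ∀ u, P u v = 0 := by
    intro v hv u
    have h1 : ∑ u, star (P u v) * P u v = 0 := by rw [← hdiag, hv]
    have h2 := (Finset.sum_eq_zero_iff_of_nonneg fun u _ => star_mul_self_nonneg (P u v)).1 h1 u
      (Finset.mem_univ u)
    exact (mul_eq_zero.1 h2).elim (fun h => star_eq_zero.1 h) id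
  set K : Finset V := Finset.univ.filter fun v => P v v ≠ 0 with hK
  refine ⟨K, ?_, ?_⟩
  · intro a ha b hb hab
    have ha' : P a a ≠ 0 := by simpa [hK] using ha
    have hb' : P b b ≠ 0 := by simpa [hK] using hb
    have h1 := mem_graphSpace_iff.1 (hfull (Matrix.single a b 1)) a b (by
      rw [Matrix.mul_apply, Finset.sum_eq_single b]
      · simp [ha', hb']
      · intro c _ hc
        rw [Matrix.mul_single_apply_of_ne _ _ _ _ _ hc, zero_mul]
      · simp)
    exact h1.resolve_left hab
  · set Q := realDiagonal (indVec K) with hQ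
    have hQsa : Qᴴ = Q := (posSemidef_realDiagonal (indVec_nonneg K)).isHermitian
    have hQQ : Q * Q = Q := by
      rw [hQ, realDiagonal_apply, Matrix.diagonal_mul_diagonal]
      congr 1
      funext v
      by_cases h : v ∈ K <;> simp [indVec, h]
    have hPQ : P * Q = P := by
      ext i j
      rw [hQ, realDiagonal_apply, Matrix.mul_diagonal]
      by_cases h : P j j = 0
      · simp [hzero j h i]
      · simp [indVec, hK, h]
    have hQP : Q * P = P := by
      have := congrArg Matrix.conjTranspose hPQ
      rwa [Matrix.conjTranspose_mul, hQsa, show Pᴴ = P from hsa] at this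
    -- From `PQ = QP = P` it follows that `Q - P` is again a projection.
    have h1 : Q - P = (Q - P)ᴴ * (Q - P) := by
      rw [Matrix.conjTranspose_sub, hQsa, show Pᴴ = P from hsa, Matrix.sub_mul, Matrix.mul_sub,
        Matrix.mul_sub, hQQ, hPQ, hQP, hid.eq]
      simp
    rw [h1]
    exact Matrix.posSemidef_conjTranspose_mul_self _

theorem closure_convexHull_fullProjection_induction {G : SimpleGraph V}
    {T : Set (Matrix V V ℂ)} (hT : Convex ℝ T) (hc : IsClosed T)
    (h : ∀ P, IsFullProjection (graphSpace G) P → P ∈ T) {C : Matrix V V ℂ}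
    (hC : C ∈ closure (convexHull ℝ {P | IsFullProjection (graphSpace G) P})) : C ∈ T :=
  closure_minimal (convexHull_min h hT) hc hC

theorem mem_fp_graphSpace {G : SimpleGraph V} {B : Matrix V V ℂ} (hB : B.PosSemidef)
    {y : V → ℝ} (hy : y ∈ cliqueHull G) (hBy : (realDiagonal y - B).PosSemidef) :
    B ∈ fp (graphSpace G) := by
  refine ⟨hB, realDiagonal y, subset_closure ?_, hBy⟩
  refine cliqueHull_induction (T := realDiagonal ⁻¹' _)
    ((convex_convexHull ℝ _).linear_preimage realDiagonal) (fun K hK => ?_) hy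
  exact subset_convexHull ℝ _ (isFullProjection_realDiagonal_indVec hK)

theorem realDiagonal_mem_fp_graphSpace {G : SimpleGraph V} {x : V → ℝ} (hx : 0 ≤ x)
    (h : x ∈ cliqueCorner G) : realDiagonal x ∈ fp (graphSpace G) := by
  obtain ⟨y, hy, hxy⟩ := h
  refine mem_fp_graphSpace (posSemidef_realDiagonal hx) hy ?_
  rw [← map_sub]
  exact posSemidef_realDiagonal (sub_nonneg.2 hxy)

/-- Pairing with `W ≥ 0` is monotone, linear and continuous, so the bound needs checking only on the
coordinate projections of cliques, where it reads off the diagonal of `W`. -/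
theorem re_trace_mul_le_of_mem_fp {G : SimpleGraph V} {B W : Matrix V V ℂ}
    (hB : B ∈ fp (graphSpace G)) (hW : W.PosSemidef) {c : ℝ}
    (hc : ∀ K : Finset V, G.IsClique K → ∑ v ∈ K, (W v v).re ≤ c) :
    (W * B).trace.re ≤ c := by
  obtain ⟨-, C, hC, hBC⟩ := hB
  have h1 := re_trace_mul_nonneg hW hBC
  rw [Matrix.mul_sub, Matrix.trace_sub, Complex.sub_re] at h1
  have h2 : (W * C).trace.re ≤ c := by
    refine closure_convexHull_fullProjection_induction (G := G)
      (T := {C | (W * C).trace.re ≤ c}) ?_ ?_ (fun P hP => ?_) hC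
    · refine convex_halfSpace_le ⟨fun X Y => ?_, fun a X => ?_⟩ c
      · simp [Matrix.mul_add]
      · simp
    · exact isClosed_le (by fun_prop) continuous_const
    · obtain ⟨K, hK, hPK⟩ := hP.exists_clique
      have h3 := re_trace_mul_nonneg hW hPK
      rw [Matrix.mul_sub, Matrix.trace_sub, Complex.sub_re, re_trace_mul_realDiagonal,
        sum_mul_indVec] at h3
      have := hc K hK
      simp only [Set.mem_ofPred_eq]
      linarith
  linarith

theorem re_diag_mem_cliqueCorner {G : SimpleGraph V} {B : Matrix V V ℂ}
    (hB : B ∈ fp (graphSpace G)) : (fun v => (B v v).re) ∈ cliqueCorner G := by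
  obtain ⟨-, C, hC, hBC⟩ := hB
  have hle : ∀ {A M : Matrix V V ℂ}, (M - A).PosSemidef →
      (fun v => (A v v).re) ≤ fun v => (M v v).re := by
    intro A M h v
    have := (Complex.le_def.1 (h.diag_nonneg (i := v))).1
    simpa using this
  have h1 : (fun v => (C v v).re) ∈ cliqueCorner G := by
    let L : Matrix V V ℂ →ₗ[ℝ] (V → ℝ) :=
      { toFun := fun A v => (A v v).re
        map_add' := fun A B => by funext v; simp
        map_smul' := fun a A => by funext v; simp }
    have hL : Continuous L := by
      change Continuous fun (A : Matrix V V ℂ) v => (A v v).re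
      fun_prop
    refine closure_convexHull_fullProjection_induction (G := G) (T := L ⁻¹' cliqueCorner G)
      ((convex_cliqueCorner G).linear_preimage L) ((isClosed_cliqueCorner G).preimage hL)
      (fun P hP => ?_) hC
    obtain ⟨K, hK, hPK⟩ := hP.exists_clique
    refine ⟨_, indVec_mem_cliqueHull hK, (hle hPK).trans (le_of_eq ?_)⟩
    funext v
    simp [realDiagonal_apply]
  obtain ⟨y, hy, hCy⟩ := h1
  exact ⟨y, hy, (hle hBC).trans hCy⟩

/-- A positive semidefinite matrix that is not dominated by an element of the clique polytope is
separated from it by a positive semidefinite matrix. -/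
theorem exists_posSemidef_separating {G : SimpleGraph V} {B : Matrix V V ℂ} (hB : B.PosSemidef)
    (h : ∀ y ∈ cliqueHull G, ¬ (realDiagonal y - B).PosSemidef) :
    ∃ W : Matrix V V ℂ, W.PosSemidef ∧ 1 < (W * B).trace.re ∧
      ∀ K : Finset V, G.IsClique K → ∑ v ∈ K, (W v v).re ≤ 1 := by
  set T : Set (Matrix V V ℂ) := {A | ∃ M ∈ realDiagonal '' cliqueHull G, (M - A).PosSemidef}
    with hT
  have hTconv : Convex ℝ T :=
    convex_posSemidef_sub ((convex_convexHull ℝ _).linear_image realDiagonal)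
  have hTclosed : IsClosed T := isClosed_setOf_exists_sub_mem
    ((isCompact_cliqueHull G).image continuous_realDiagonal) isClosed_posSemidef
  have hBT : B ∉ T := by
    rintro ⟨_, ⟨y, hy, rfl⟩, hyB⟩
    exact h y hy hyB
  have : LocallyConvexSpace ℝ (Matrix V V ℂ) :=
    inferInstanceAs (LocallyConvexSpace ℝ (V → V → ℂ))
  obtain ⟨f, u, hfu, huB⟩ := geometric_hahn_banach_closed_point hTconv hTclosed hBT
  obtain ⟨W, hWh, hW⟩ := exists_re_trace_mul f.toLinearMap
  have hzero : (0 : V → ℝ) ∈ cliqueHull G := by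
    have : indVec (∅ : Finset V) = 0 := by funext v; simp [indVec]
    rw [← this]
    exact indVec_mem_cliqueHull (by simp)
  -- `T` contains every negative semidefinite matrix, being downward closed with `0 ∈ T`. If `f X <
  -- 0`, the multiple `-(u / (-f X)) • X` lies in `T` and has value exactly `u`, against the strict
  -- bound.
  have hneg : ∀ X : Matrix V V ℂ, X.PosSemidef → 0 ≤ f X := by
    intro X hX
    by_contra! hcon
    have hu : 0 < u := by
      simpa using hfu 0 ⟨0, ⟨0, hzero, by simp⟩, by simpa using Matrix.PosSemidef.zero⟩
    have ht : 0 ≤ u / (-f X) := (div_pos hu (by linarith)).le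
    have h1 := hfu (-((u / (-f X)) • X)) ⟨0, ⟨0, hzero, by simp⟩, by simpa using hX.smul ht⟩
    rw [map_neg, map_smul, smul_eq_mul, div_neg, neg_mul, neg_neg,
      div_mul_cancel₀ _ hcon.ne] at h1
    exact lt_irrefl _ h1
  have hWpos : W.PosSemidef := by
    -- The quadratic form of `W` at `x` is the value of `f` on the rank-one matrix `x x†`.
    refine Matrix.PosSemidef.of_dotProduct_mulVec_nonneg hWh fun x => ?_
    have hx := Matrix.posSemidef_vecMulVec_self_star x
    have h1 := hneg _ hx
    have h2 := hW _ hx.isHermitian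
    rw [Matrix.mul_vecMulVec, Matrix.trace_vecMulVec, dotProduct_comm] at h2
    rw [Complex.le_def]
    refine ⟨?_, ?_⟩
    · rw [← h2]; exact h1
    · simpa using (hWh.im_star_dotProduct_mulVec_self x).symm
  have hK : ∀ K : Finset V, G.IsClique K → ∑ v ∈ K, (W v v).re < u := by
    intro K hK
    have hd := posSemidef_realDiagonal (indVec_nonneg K)
    have h1 := hfu (realDiagonal (indVec K))
      ⟨_, ⟨_, indVec_mem_cliqueHull hK, rfl⟩, by simpa using Matrix.PosSemidef.zero⟩
    have h2 := hW _ hd.isHermitian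
    rw [re_trace_mul_realDiagonal, sum_mul_indVec] at h2
    rw [← h2]
    exact h1
  have hu : 0 < u := by simpa using hK ∅ (by simp)
  refine ⟨u⁻¹ • W, hWpos.smul (inv_nonneg.2 hu.le), ?_, fun K hKc => ?_⟩
  · have h1 : u < (W * B).trace.re := by
      rw [← hW B hB.isHermitian]; exact huB
    rw [Matrix.smul_mul, Matrix.trace_smul, Complex.smul_re, smul_eq_mul, lt_inv_mul_iff₀ hu,
      mul_one]
    exact h1
  · simp only [Matrix.smul_apply, Complex.smul_re, smul_eq_mul, ← Finset.mul_sum]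
    rw [inv_mul_le_iff₀ hu, mul_one]
    exact (hK K hKc).le

theorem fp_subset_psiAntiblocker (G : SimpleGraph V) (D : BlockDecomposition (vertexAlgebra V)) :
    fp (graphSpace G) ⊆ psiAntiblocker D (fp (graphSpace Gᶜ)) := by
  intro B hB
  refine ⟨hB.1, ?_⟩
  rintro W ⟨hW, hWD⟩
  rw [blockScale_vertexAlgebra] at hWD
  obtain ⟨y, hy, hWy⟩ := re_diag_mem_cliqueCorner hWD
  -- The diagonal of `W` is below a convex combination `y` of independent sets, each of which meets
  -- `K` at most once.
  refine re_trace_mul_le_of_mem_fp hB hW fun K hK => ?_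
  calc ∑ v ∈ K, (W v v).re ≤ ∑ v ∈ K, y v :=
        Finset.sum_le_sum fun v _ => by simpa using hWy v
    _ = ∑ v, indVec K v * y v := by simp_rw [mul_comm (indVec K _)]; rw [sum_mul_indVec]
    _ ≤ 1 := sum_mul_le_of_mem_cliqueHull (fun S hS => by
        have h1 := card_inter_le_one hK hS
        rw [Finset.inter_comm] at h1
        simp only [indVec, Finset.sum_ite_mem, Finset.sum_const, nsmul_eq_mul, mul_one]
        exact_mod_cast h1) hy

theorem psiAntiblocker_subset_fp {G : SimpleGraph V} (hG : IsPerfect G)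
    (D : BlockDecomposition (vertexAlgebra V)) :
    psiAntiblocker D (fp (graphSpace Gᶜ)) ⊆ fp (graphSpace G) := by
  rintro B ⟨hB, hBW⟩
  by_contra hcon
  obtain ⟨W, hW, hWB, hWK⟩ := exists_posSemidef_separating (G := G) hB
    fun y hy hyB => hcon (mem_fp_graphSpace hB hy hyB)
  have hdiag : (0 : V → ℝ) ≤ fun v => (W v v).re := fun v =>
    (Complex.le_def.1 (hW.diag_nonneg (i := v))).1
  -- The diagonal of the separating `W` has weight at most one on cliques of `G`, so perfection
  -- places it below the independent set polytope. Thus `W` is an admissible test, and it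
  -- contradicts membership of `B` in the anti-blocker.
  refine (hBW W ⟨hW, ?_⟩).not_gt hWB
  rw [blockScale_vertexAlgebra, realDiagonal_re_diag hW]
  exact realDiagonal_mem_fp_graphSpace hdiag
    (hG.isCliquePolyhedral_compl _ hdiag (by simpa using hWK))

/-- Diagonal matrices suffice: `realDiagonal b` pairs with `W` only through the diagonal of `W`,
which lies below the independent set polytope, where `b` is at most one. -/
theorem isCliquePolyhedral_of_psiAntiblocker_subset_fp {G : SimpleGraph V}
    (D : BlockDecomposition (vertexAlgebra V))
    (h : psiAntiblocker D (fp (graphSpace Gᶜ)) ⊆ fp (graphSpace G)) :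
    IsCliquePolyhedral G := by
  intro b hb hbK
  have hmem : realDiagonal b ∈ fp (graphSpace G) := by
    refine h ⟨posSemidef_realDiagonal hb, ?_⟩
    rintro W ⟨-, hWD⟩
    rw [blockScale_vertexAlgebra] at hWD
    obtain ⟨y, hy, hWy⟩ := re_diag_mem_cliqueCorner hWD
    rw [re_trace_mul_realDiagonal]
    refine le_trans (Finset.sum_le_sum fun v _ => ?_) (sum_mul_le_of_mem_cliqueHull hbK hy)
    rw [mul_comm]
    exact mul_le_mul_of_nonneg_left (by simpa using hWy v) (hb v)
  simpa [realDiagonal_apply] using re_diag_mem_cliqueCorner hmem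

end FullProjection

end NCGraph

theorem mainTheorem9 {V : Type*} [Fintype V] [DecidableEq V] (G : SimpleGraph V)
    (D : NCGraph.BlockDecomposition (NCGraph.vertexAlgebra V)) :
    NCGraph.IsFPPerfect D (NCGraph.graphSpace G) ↔ NCGraph.IsPerfect G := by
  rw [NCGraph.IsFPPerfect, NCGraph.compl_graphSpace]
  constructor
  · rintro ⟨-, h⟩
    exact (NCGraph.isCliquePolyhedral_of_psiAntiblocker_subset_fp D h.ge).compl.isPerfect
  · exact fun hG => ⟨NCGraph.isVertexGraph_graphSpace G,
      (NCGraph.fp_subset_psiAntiblocker G D).antisymm (NCGraph.psiAntiblocker_subset_fp hG D)⟩
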